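/- Let $V_0,V_1,\dots$ and $Y_0,Y_1,\dots$ be two sequences of real random variables, each of them i.i.d., the two sequences being independent of each other. For an initial state $W_0\in[0,\infty)$ let $$W_{i+1}=[V_iW_i+Y_i]^+,\qquad i=0,1,2,\dots,$$ where $[x]^+=\max(x,0)$. If $\mathbb{P}(V_0\leqslant 0)>0$ and $Y_0\geqslant 0$ almost surely, then the process $\{W_i\}$ admits a stationary distribution: there is a probability measure $\pi$ on $[0,\infty)$ such that, if $W_0$ has law $\pi$ and is independent of the sequences $\{V_i\}$ and $\{Y_i\}$, then $W_i$ has law $\pi$ for every $i\geqslant 0$. -/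

import Mathlib

open MeasureTheory ProbabilityTheory
open scoped NNReal

/-- The process `W_0 = w`, `W_{i+1} = [V_i W_i + Y_i]⁺` with state space `[0, ∞)`.
Here `Real.toNNReal x` is the positive part `max x 0`. -/
noncomputable def reflectedProcess {Ω : Type*} (V Y : ℕ → Ω → ℝ) (w : ℝ≥0) : ℕ → Ω → ℝ≥0
  | 0, _ => w
  | i + 1, ω => Real.toNNReal (V i ω * (reflectedProcess V Y w i ω : ℝ) + Y i ω)

/-- A measure `π` on `[0, ∞)` is a stationary distribution of the process driven by `(V_i, Y_i)` if
it is a probability measure and, when the initial state `W_0` has law `π` and is independent of the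
driving sequences (so that the pair lives on the product space with measure `π ⊗ μ`), every `W_i`
has law `π`. -/
def IsStationaryDistribution {Ω : Type*} [MeasurableSpace Ω] (μ : Measure Ω)
    (V Y : ℕ → Ω → ℝ) (π : Measure ℝ≥0) : Prop :=
  IsProbabilityMeasure π ∧
    ∀ i : ℕ, (π.prod μ).map (fun p : ℝ≥0 × Ω => reflectedProcess V Y p.1 i p.2) = π

/-! The pairs `(V i, Y i)` are i.i.d., so the process is a Markov chain whose step `w ↦ [v w + y]⁺`
is continuous in `w`. By Krylov–Bogoliubov (`exists_pushStep_eq_self`) an invariant law exists once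
the laws of the chain started at 0 are tight.

Tightness comes from `p = P(V > 0) < 1`. While `(v, y)` stays in a compact set, the next state can
be large only if `v > 0` and the current state is large. Hence each step multiplies the tail by `p`,
up to a small error, and `k` steps give `p ^ k` plus an error, uniformly in time.

Invariance under one step passes to every `W_i` because `W_i` is independent of `(V i, Y i)`
(`map_reflectedProcess_succ`). -/

open Filter Topology Set
open scoped ENNReal BoundedContinuousFunction

/-! ### Invariant laws of continuous random maps. -/

section KrylovBogoliubov

variable {X B : Type*} [MeasurableSpace X] [MeasurableSpace B]

/-- The law of `φ (x, b)` when `x` has law `π` and `b` is independent of `x` with law `β`. -/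
noncomputable def pushStep (β : Measure B) (φ : X × B → X) (π : Measure X) : Measure X :=
  (π.prod β).map φ

lemma isProbabilityMeasure_pushStep (β : Measure B) [IsProbabilityMeasure β] {φ : X × B → X}
    (hφ : Measurable φ) (π : Measure X) [IsProbabilityMeasure π] :
    IsProbabilityMeasure (pushStep β φ π) :=
  Measure.isProbabilityMeasure_map hφ.aemeasurable

/-- The averages `(m 0 + ⋯ + m n) / (n + 1)` of a sequence of measures. -/
noncomputable def cesaroMeasure (m : ℕ → Measure X) (n : ℕ) : Measure X :=
  ((n : ℝ≥0∞) + 1)⁻¹ • ∑ i ∈ Finset.range (n + 1), m i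

lemma cesaroMeasure_apply_le (m : ℕ → Measure X) {s : Set X} {ε : ℝ≥0∞} (h : ∀ i, m i s ≤ ε)
    (n : ℕ) : cesaroMeasure m n s ≤ ε := by
  simp only [cesaroMeasure, Measure.smul_apply, Measure.finsetSum_apply, smul_eq_mul]
  calc ((n : ℝ≥0∞) + 1)⁻¹ * ∑ i ∈ Finset.range (n + 1), m i s
      ≤ ((n : ℝ≥0∞) + 1)⁻¹ * ∑ i ∈ Finset.range (n + 1), ε := by gcongr with i; exact h i
    _ = (((n : ℝ≥0∞) + 1)⁻¹ * ((n : ℝ≥0∞) + 1)) * ε := by simp [mul_assoc]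
    _ = ε := by
      rw [ENNReal.inv_mul_cancel (by simp) (by finiteness), one_mul]

lemma isProbabilityMeasure_cesaroMeasure (m : ℕ → Measure X) [∀ i, IsProbabilityMeasure (m i)]
    (n : ℕ) : IsProbabilityMeasure (cesaroMeasure m n) := by
  constructor
  simp only [cesaroMeasure, Measure.smul_apply, Measure.finsetSum_apply, smul_eq_mul, measure_univ,
    Finset.sum_const, Finset.card_range, nsmul_eq_mul, mul_one]
  push_cast
  exact ENNReal.inv_mul_cancel (by simp) (by finiteness)

variable [TopologicalSpace X] [BorelSpace X]

lemma integral_cesaroMeasure (m : ℕ → Measure X) [∀ i, IsProbabilityMeasure (m i)] (n : ℕ)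
    (f : X →ᵇ ℝ) :
    ∫ x, f x ∂cesaroMeasure m n
      = ((n : ℝ) + 1)⁻¹ * ∑ i ∈ Finset.range (n + 1), ∫ x, f x ∂m i := by
  rw [cesaroMeasure, integral_smul_measure, integral_finsetSum_measure]
  · have : (((n : ℝ≥0∞) + 1)⁻¹).toReal = ((n : ℝ) + 1)⁻¹ := by
      rw [ENNReal.toReal_inv, ENNReal.toReal_add (by simp) (by simp)]; simp
    rw [this, smul_eq_mul]
  · exact fun i _ => f.integrable _

/-- The Markov operator of a continuous random map, on bounded continuous functions. -/
noncomputable def markovOperator [FirstCountableTopology X] (β : Measure B) [IsProbabilityMeasure β]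
    (φ : X × B → X) (hφ : Measurable φ) (hc : ∀ b, Continuous fun x => φ (x, b)) (f : X →ᵇ ℝ) :
    X →ᵇ ℝ :=
  BoundedContinuousFunction.ofNormedAddCommGroup (fun x => ∫ b, f (φ (x, b)) ∂β)
    (continuous_of_dominated (bound := fun _ => ‖f‖)
      (fun x => ((f.continuous.measurable.comp
        (hφ.comp measurable_prodMk_left))).aestronglyMeasurable)
      (fun x => ae_of_all _ fun b => f.norm_coe_le_norm _) (integrable_const _)
      (ae_of_all _ fun b => f.continuous.comp (hc b)))
    ‖f‖
    (fun x => by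
      simpa using norm_integral_le_of_norm_le_const (μ := β)
        (ae_of_all _ fun b => f.norm_coe_le_norm (φ (x, b))))

lemma integral_pushStep [FirstCountableTopology X] (β : Measure B) [IsProbabilityMeasure β]
    (φ : X × B → X) (hφ : Measurable φ) (hc : ∀ b, Continuous fun x => φ (x, b)) (f : X →ᵇ ℝ)
    (π : Measure X) [IsProbabilityMeasure π] :
    ∫ x, f x ∂pushStep β φ π = ∫ x, markovOperator β φ hφ hc f x ∂π := by
  have hm : Measurable fun p => f (φ p) := f.continuous.measurable.comp hφ
  rw [pushStep, integral_map hφ.aemeasurable f.continuous.measurable.aestronglyMeasurable,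
    integral_prod]
  · rfl
  · exact Integrable.of_bound hm.aestronglyMeasurable ‖f‖
      (ae_of_all _ fun p => f.norm_coe_le_norm _)

/-- **Krylov–Bogoliubov**: a continuous random map with a tight orbit of laws has an invariant
probability measure. -/
theorem exists_pushStep_eq_self [TopologicalSpace.MetrizableSpace X] (β : Measure B)
    [IsProbabilityMeasure β] (φ : X × B → X) (hφ : Measurable φ)
    (hc : ∀ b, Continuous fun x => φ (x, b)) (m : ℕ → Measure X)
    [∀ i, IsProbabilityMeasure (m i)] (hm : ∀ n, m (n + 1) = pushStep β φ (m n))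
    (htight : IsTightMeasureSet (range m)) :
    ∃ π : Measure X, IsProbabilityMeasure π ∧ pushStep β φ π = π := by
  have hA := isProbabilityMeasure_cesaroMeasure m
  let A : ℕ → ProbabilityMeasure X := fun n => ⟨cesaroMeasure m n, hA n⟩
  have hcomp : IsCompact (closure (range A)) := by
    apply isCompact_closure_of_isTightMeasureSet
    rw [isTightMeasureSet_iff_exists_isCompact_measure_compl_le] at htight ⊢
    intro ε hε
    obtain ⟨K, hK, h⟩ := htight ε hε
    refine ⟨K, hK, ?_⟩
    rintro _ ⟨_, ⟨n, rfl⟩, rfl⟩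
    exact cesaroMeasure_apply_le m (fun i => h _ ⟨i, rfl⟩) n
  -- A limit along a nonprincipal ultrafilter replaces the choice of a convergent subsequence.
  obtain ⟨π, -, hπ⟩ := isCompact_iff_ultrafilter_le_nhds.1 hcomp ((hyperfilter ℕ).map A) (by
    rw [le_principal_iff]
    exact Filter.mem_map.2 (mem_of_superset univ_mem fun n _ => subset_closure ⟨n, rfl⟩))
  have hlim : Tendsto A (hyperfilter ℕ) (𝓝 π) := hπ
  rw [ProbabilityMeasure.tendsto_iff_forall_integral_tendsto] at hlim
  have := isProbabilityMeasure_pushStep β hφ (π : Measure X)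
  refine ⟨π, inferInstance, ?_⟩
  refine ext_of_forall_integral_eq_of_IsFiniteMeasure fun f => ?_
  rw [integral_pushStep β φ hφ hc]
  set g := markovOperator β φ hφ hc f with hg
  -- The sum telescopes, so averaging makes the defect of invariance at most `2‖f‖ / (n + 1)`. Since
  -- `g` is again bounded and continuous, the weak limit applies to it too.
  have hdiff : ∀ n, ∫ x, g x ∂(A n : Measure X) - ∫ x, f x ∂(A n : Measure X)
      = ((n : ℝ) + 1)⁻¹ * (∫ x, f x ∂m (n + 1) - ∫ x, f x ∂m 0) := by
    intro n
    change ∫ x, g x ∂cesaroMeasure m n - ∫ x, f x ∂cesaroMeasure m n = _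
    rw [integral_cesaroMeasure, integral_cesaroMeasure, ← mul_sub, ← Finset.sum_sub_distrib,
      ← Finset.sum_range_sub (fun i => ∫ x, f x ∂m i)]
    congr 1
    refine Finset.sum_congr rfl fun i _ => ?_
    rw [hm i, integral_pushStep β φ hφ hc]
  have hzero : Tendsto (fun n : ℕ => ∫ x, g x ∂(A n : Measure X) - ∫ x, f x ∂(A n : Measure X))
      atTop (𝓝 0) := by
    have hb : Tendsto (fun n : ℕ => ((n : ℝ) + 1)⁻¹ * (‖f‖ + ‖f‖)) atTop (𝓝 0) := by
      simpa using (tendsto_one_div_add_atTop_nhds_zero_nat (𝕜 := ℝ)).mul_const (‖f‖ + ‖f‖)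
    refine squeeze_zero_norm (fun n => ?_) hb
    have hbd : ∀ i, ‖∫ x, f x ∂m i‖ ≤ ‖f‖ := fun i => f.norm_integral_le_norm (μ := m i)
    rw [hdiff, norm_mul, Real.norm_of_nonneg (by positivity)]
    gcongr
    exact (norm_sub_le _ _).trans (add_le_add (hbd _) (hbd _))
  have hle : (hyperfilter ℕ : Filter ℕ) ≤ atTop := Nat.hyperfilter_le_atTop
  exact sub_eq_zero.1 (tendsto_nhds_unique ((hlim g).sub (hlim f)) (hzero.mono_left hle))

end KrylovBogoliubov

/-! ### Uniform tail bounds for the chain started at 0. -/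

section Tightness

/-- One step of the reflected process: `(w, (v, y)) ↦ [v w + y]⁺`. -/
noncomputable def reflectedStep (p : ℝ≥0 × (ℝ × ℝ)) : ℝ≥0 :=
  Real.toNNReal (p.2.1 * (p.1 : ℝ) + p.2.2)

lemma measurable_reflectedStep : Measurable reflectedStep := by
  unfold reflectedStep; fun_prop

lemma continuous_reflectedStep (b : ℝ × ℝ) : Continuous fun w => reflectedStep (w, b) := by
  unfold reflectedStep; fun_prop

/-- The error `δ` pays for inputs outside a compact set that depends only on `β`, so `R` serves all
`π` at once. -/
lemma exists_pushStep_reflectedStep_Ioi_le (β : Measure (ℝ × ℝ)) [IsProbabilityMeasure β]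
    {δ : ℝ≥0∞} (hδ : 0 < δ) (r : ℝ≥0) :
    ∃ R : ℝ≥0, ∀ (π : Measure ℝ≥0) [IsProbabilityMeasure π],
      pushStep β reflectedStep π (Ioi R) ≤ β {b | 0 < b.1} * π (Ioi r) + δ := by
  obtain ⟨K, hK, hKδ⟩ := isTightMeasureSet_iff_exists_isCompact_measure_compl_le.1
    (isTightMeasureSet_singleton (μ := β)) δ hδ
  obtain ⟨M, hM0, hM⟩ := hK.isBounded.exists_pos_norm_le
  lift M to ℝ≥0 using hM0.le
  -- For `|v|, |y| ≤ M`, the value `v w + y` is at most `M` if `v ≤ 0`, and at most `M r + M` if `w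
  -- ≤ r`.
  refine ⟨M * r + M, fun π _ => ?_⟩
  rw [pushStep, Measure.map_apply measurable_reflectedStep measurableSet_Ioi]
  have hsub : reflectedStep ⁻¹' Ioi (M * r + M) ⊆ (Ioi r ×ˢ {b | 0 < b.1}) ∪ (univ ×ˢ Kᶜ) := by
    rintro ⟨w, v, y⟩ h
    by_cases hb : (v, y) ∈ K
    · left
      have hn := hM _ hb
      rw [Prod.norm_mk, sup_le_iff] at hn
      have hv := (le_abs_self v).trans hn.1
      have hy := (le_abs_self y).trans hn.2
      simp only [mem_preimage, mem_Ioi, reflectedStep, Real.lt_toNNReal_iff_coe_lt] at h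
      push_cast at h
      have hw := w.coe_nonneg
      have hr := r.coe_nonneg
      have hpos : 0 < v := by
        by_contra! hv0
        nlinarith [mul_nonneg hM0.le hr, mul_nonneg (neg_nonneg.2 hv0) hw]
      refine ⟨?_, hpos⟩
      rw [mem_Ioi]
      by_contra! hwr
      have hwr' : (w : ℝ) ≤ r := hwr
      nlinarith [mul_le_mul hv hwr' hw hM0.le]
    · exact Or.inr ⟨mem_univ _, hb⟩
  calc (π.prod β) (reflectedStep ⁻¹' Ioi (M * r + M))
      ≤ (π.prod β) (Ioi r ×ˢ {b | 0 < b.1}) + (π.prod β) (univ ×ˢ Kᶜ) :=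
        (measure_mono hsub).trans (measure_union_le _ _)
    _ ≤ β {b | 0 < b.1} * π (Ioi r) + δ := by
        rw [Measure.prod_prod, Measure.prod_prod, mul_comm, measure_univ, one_mul]
        gcongr
        exact hKδ β rfl

/-- Iterates the one-step bound `k` times, halving the error allowance each time. The radius depends
on `k` and `δ` but not on `n`; times `n < k` are covered because the start at 0 has no tail. -/
lemma exists_forall_Ioi_le_pow_add (β : Measure (ℝ × ℝ)) [IsProbabilityMeasure β]
    (m : ℕ → Measure ℝ≥0) [∀ i, IsProbabilityMeasure (m i)] (h0 : m 0 = Measure.dirac 0)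
    (hm : ∀ n, m (n + 1) = pushStep β reflectedStep (m n)) (k : ℕ) {δ : ℝ≥0∞} (hδ : 0 < δ) :
    ∃ R : ℝ≥0, ∀ n, m n (Ioi R) ≤ β {b | 0 < b.1} ^ k + δ := by
  induction k generalizing δ with
  | zero => exact ⟨0, fun n => prob_le_one.trans (by simp)⟩
  | succ k ih =>
    have hδ2 : 0 < δ / 2 := ENNReal.half_pos hδ.ne'
    obtain ⟨r, hr⟩ := ih hδ2
    obtain ⟨R, hR⟩ := exists_pushStep_reflectedStep_Ioi_le β hδ2 r
    refine ⟨R, fun n => ?_⟩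
    cases n with
    | zero => simp [h0]
    | succ n =>
      rw [hm]
      calc pushStep β reflectedStep (m n) (Ioi R)
          ≤ β {b | 0 < b.1} * m n (Ioi r) + δ / 2 := hR _
        _ ≤ β {b | 0 < b.1} * (β {b | 0 < b.1} ^ k + δ / 2) + δ / 2 := by gcongr; exact hr n
        _ = β {b | 0 < b.1} ^ (k + 1) + (β {b | 0 < b.1} * (δ / 2) + δ / 2) := by ring
        _ ≤ β {b | 0 < b.1} ^ (k + 1) + (1 * (δ / 2) + δ / 2) := by gcongr; exact prob_le_one
        _ = _ := by rw [one_mul, ENNReal.add_halves]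

lemma isTightMeasureSet_range_of_pushStep (β : Measure (ℝ × ℝ)) [IsProbabilityMeasure β]
    (hβ : β {b | 0 < b.1} < 1)
    (m : ℕ → Measure ℝ≥0) [∀ i, IsProbabilityMeasure (m i)] (h0 : m 0 = Measure.dirac 0)
    (hm : ∀ n, m (n + 1) = pushStep β reflectedStep (m n)) :
    IsTightMeasureSet (range m) := by
  rw [isTightMeasureSet_iff_exists_isCompact_measure_compl_le]
  intro ε hε
  have hε2 : 0 < ε / 2 := ENNReal.half_pos hε.ne'
  obtain ⟨k, hk⟩ := ((ENNReal.tendsto_pow_atTop_nhds_zero_of_lt_one hβ).eventually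
    (Iic_mem_nhds hε2)).exists
  obtain ⟨R, hR⟩ := exists_forall_Ioi_le_pow_add β m h0 hm k hε2
  refine ⟨Icc 0 R, isCompact_Icc, ?_⟩
  rintro _ ⟨n, rfl⟩
  have : (Icc 0 R)ᶜ = Ioi R := by ext x; simp
  rw [this]
  exact (hR n).trans ((add_le_add_left hk _).trans (ENNReal.add_halves ε).le)

/-- The one-step transition has an invariant law as soon as `v ≤ 0` with positive probability. -/
theorem exists_pushStep_reflectedStep_eq_self (β : Measure (ℝ × ℝ)) [IsProbabilityMeasure β]
    (hβ : β {b | 0 < b.1} < 1) :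
    ∃ π : Measure ℝ≥0, IsProbabilityMeasure π ∧ pushStep β reflectedStep π = π := by
  let m : ℕ → Measure ℝ≥0 := fun n => (pushStep β reflectedStep)^[n] (Measure.dirac 0)
  have hm : ∀ n, m (n + 1) = pushStep β reflectedStep (m n) := fun n =>
    Function.iterate_succ_apply' _ _ _
  have : ∀ n, IsProbabilityMeasure (m n) := by
    intro n
    induction n with
    | zero => exact inferInstanceAs (IsProbabilityMeasure (Measure.dirac 0))
    | succ n ih => rw [hm]; exact isProbabilityMeasure_pushStep β measurable_reflectedStep _
  exact exists_pushStep_eq_self β reflectedStep measurable_reflectedStep continuous_reflectedStep m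
    hm (isTightMeasureSet_range_of_pushStep β hβ m rfl hm)

end Tightness

/-! ### The Markov property from the independence hypotheses. -/

section Independence

variable {Ω : Type*} [MeasurableSpace Ω]

/-- The hypotheses make the four variables jointly independent, so they may be regrouped; on laws
this is Tonelli in the two middle coordinates. -/
lemma indepFun_prodMk_prodMk_of_indepFun {α α' γ γ' : Type*} [MeasurableSpace α]
    [MeasurableSpace α'] [MeasurableSpace γ] [MeasurableSpace γ'] {μ : Measure Ω}
    [IsProbabilityMeasure μ] {X : Ω → α} {X' : Ω → α'} {Z : Ω → γ} {Z' : Ω → γ'}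
    (hX : Measurable X) (hX' : Measurable X') (hZ : Measurable Z) (hZ' : Measurable Z')
    (hXX' : IndepFun X X' μ) (hZZ' : IndepFun Z Z' μ)
    (h : IndepFun (fun ω => (X ω, X' ω)) (fun ω => (Z ω, Z' ω)) μ) :
    IndepFun (fun ω => (X ω, Z ω)) (fun ω => (X' ω, Z' ω)) μ := by
  have hXZ : IndepFun X Z μ := h.comp measurable_fst measurable_fst
  have hXZ' : IndepFun X' Z' μ := h.comp measurable_snd measurable_snd
  have := Measure.isProbabilityMeasure_map (μ := μ) hX.aemeasurable
  have := Measure.isProbabilityMeasure_map (μ := μ) hX'.aemeasurable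
  have := Measure.isProbabilityMeasure_map (μ := μ) hZ.aemeasurable
  have := Measure.isProbabilityMeasure_map (μ := μ) hZ'.aemeasurable
  rw [indepFun_iff_map_prod_eq_prod_map_map (by fun_prop) (by fun_prop)] at hXX' hZZ' h hXZ hXZ' ⊢
  rw [hXX', hZZ'] at h
  rw [hXZ, hXZ']
  let σ : (α × α') × (γ × γ') → (α × γ) × (α' × γ') := fun p => ((p.1.1, p.2.1), (p.1.2, p.2.2))
  have hσ : Measurable σ := by fun_prop
  have hmap : μ.map (fun ω => ((X ω, Z ω), (X' ω, Z' ω)))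
      = (μ.map (fun ω => ((X ω, X' ω), (Z ω, Z' ω)))).map σ := by
    rw [Measure.map_map hσ (by fun_prop)]; rfl
  rw [hmap, h]
  refine Measure.ext_of_lintegral _ fun f hf => ?_
  rw [lintegral_map hf hσ, lintegral_prod _ (by fun_prop), lintegral_prod _ (by fun_prop),
    lintegral_prod _ (by fun_prop), lintegral_prod _ (by fun_prop)]
  refine lintegral_congr fun a => ?_
  have e1 : ∀ a', ∫⁻ p, f (σ ((a, a'), p)) ∂(μ.map Z).prod (μ.map Z')
      = ∫⁻ c, ∫⁻ c', f ((a, c), (a', c')) ∂μ.map Z' ∂μ.map Z := fun a' => by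
    rw [lintegral_prod _ (by fun_prop)]
  have e2 : ∀ c, ∫⁻ p, f ((a, c), p) ∂(μ.map X').prod (μ.map Z')
      = ∫⁻ a', ∫⁻ c', f ((a, c), (a', c')) ∂μ.map Z' ∂μ.map X' := fun c => by
    rw [lintegral_prod _ (by fun_prop)]
  simp_rw [e1, e2]
  exact lintegral_lintegral_swap (by fun_prop)

lemma measurable_reflectedProcess {V Y : ℕ → Ω → ℝ} (hV : ∀ i, Measurable (V i))
    (hY : ∀ i, Measurable (Y i)) (i : ℕ) :
    Measurable fun p : ℝ≥0 × Ω => reflectedProcess V Y p.1 i p.2 := by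
  induction i with
  | zero => exact measurable_fst
  | succ i ih =>
    have := hV i
    have := hY i
    simp only [reflectedProcess]
    fun_prop

lemma reflectedProcess_congr {Ω Ω' : Type*} {V Y : ℕ → Ω → ℝ} {V' Y' : ℕ → Ω' → ℝ} {ω : Ω} {ω' : Ω'}
    {i : ℕ} (hV : ∀ j < i, V j ω = V' j ω') (hY : ∀ j < i, Y j ω = Y' j ω') (w : ℝ≥0) :
    reflectedProcess V Y w i ω = reflectedProcess V' Y' w i ω' := by
  induction i with
  | zero => rfl
  | succ i ih =>
    simp only [reflectedProcess]
    rw [ih (fun j hj => hV j (by omega)) (fun j hj => hY j (by omega)), hV i (by omega),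
      hY i (by omega)]

/-- Extension by zero of a finite sequence. -/
def extendZero (i : ℕ) (v : Finset.range i → ℝ) (j : ℕ) : ℝ :=
  if h : j ∈ Finset.range i then v ⟨j, h⟩ else 0

lemma measurable_extendZero (i j : ℕ) : Measurable fun v => extendZero i v j := by
  unfold extendZero
  split_ifs <;> fun_prop

/-- The process at time `i` as a function of the initial state and the first `i` inputs. -/
noncomputable def reflectedOfPast (i : ℕ)
    (q : ℝ≥0 × ((Finset.range i → ℝ) × (Finset.range i → ℝ))) : ℝ≥0 :=
  reflectedProcess (fun j p => extendZero i p.1 j) (fun j p => extendZero i p.2 j) q.1 i q.2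

lemma measurable_reflectedOfPast (i : ℕ) : Measurable (reflectedOfPast i) :=
  measurable_reflectedProcess (fun j => (measurable_extendZero i j).comp measurable_fst)
    (fun j => (measurable_extendZero i j).comp measurable_snd) i

/-- Only inputs with index below `i` are read, so the zero padding is harmless. -/
lemma reflectedProcess_eq_reflectedOfPast {Ω : Type*} (V Y : ℕ → Ω → ℝ) (w : ℝ≥0) (i : ℕ) (ω : Ω) :
    reflectedProcess V Y w i ω = reflectedOfPast i (w, (fun j => V j ω, fun j => Y j ω)) := by
  refine reflectedProcess_congr (fun j hj => ?_) (fun j hj => ?_) w <;>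
    simp [extendZero, hj]

variable {μ : Measure Ω} [IsProbabilityMeasure μ] {V Y : ℕ → Ω → ℝ}

lemma indepFun_past_present (hVmeas : ∀ i, Measurable (V i)) (hYmeas : ∀ i, Measurable (Y i))
    (hVindep : iIndepFun V μ) (hYindep : iIndepFun Y μ)
    (hVY : IndepFun (fun ω (i : ℕ) => V i ω) (fun ω (i : ℕ) => Y i ω) μ) (i : ℕ) :
    IndepFun (fun ω => ((fun j : Finset.range i => V j ω), (fun j : Finset.range i => Y j ω)))
      (fun ω => (V i ω, Y i ω)) μ := by
  have key : ∀ {U : ℕ → Ω → ℝ}, (∀ i, Measurable (U i)) → iIndepFun U μ →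
      IndepFun (fun ω (j : Finset.range i) => U j ω) (U i) μ := fun hU h =>
    (h.indepFun_finset (Finset.range i) {i} (by simp) hU).comp measurable_id
      (measurable_pi_apply (⟨i, by simp⟩ : ({i} : Finset ℕ)))
  have hφ : Measurable fun v : ℕ → ℝ => ((fun j : Finset.range i => v j), v i) := by fun_prop
  exact indepFun_prodMk_prodMk_of_indepFun (by fun_prop) (hVmeas i) (by fun_prop) (hYmeas i)
    (key hVmeas hVindep) (key hYmeas hYindep) (hVY.comp hφ hφ)

lemma map_reflectedProcess_succ (hVmeas : ∀ i, Measurable (V i)) (hYmeas : ∀ i, Measurable (Y i))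
    (hVindep : iIndepFun V μ) (hYindep : iIndepFun Y μ)
    (hVY : IndepFun (fun ω (i : ℕ) => V i ω) (fun ω (i : ℕ) => Y i ω) μ)
    (π : Measure ℝ≥0) [IsProbabilityMeasure π] (i : ℕ) :
    (π.prod μ).map (fun p : ℝ≥0 × Ω => reflectedProcess V Y p.1 (i + 1) p.2)
      = pushStep (μ.map fun ω => (V i ω, Y i ω)) reflectedStep
        ((π.prod μ).map fun p : ℝ≥0 × Ω => reflectedProcess V Y p.1 i p.2) := by
  set past : Ω → (Finset.range i → ℝ) × (Finset.range i → ℝ) :=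
    fun ω => ((fun j => V j ω), (fun j => Y j ω)) with hpast
  set present : Ω → ℝ × ℝ := fun ω => (V i ω, Y i ω) with hpresent
  have hpast_m : Measurable past := by fun_prop
  have hpresent_m : Measurable present := by fun_prop
  have hsnd : (π.prod μ).map Prod.snd = μ := by simp
  have hind : IndepFun (fun p : ℝ≥0 × Ω => past p.2) (fun p => present p.2) (π.prod μ) := by
    have h := indepFun_past_present hVmeas hYmeas hVindep hYindep hVY i
    rw [indepFun_iff_map_prod_eq_prod_map_map (by fun_prop) (by fun_prop)] at h ⊢
    rw [← hsnd, Measure.map_map (by fun_prop) measurable_snd,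
      Measure.map_map (by fun_prop) measurable_snd,
      Measure.map_map (by fun_prop) measurable_snd] at h
    exact h
  -- The constant `()` pairs with the initial state so that the regrouping lemma can adjoin that
  -- state to the past.
  have hstart : IndepFun (fun p : ℝ≥0 × Ω => (p.1, ())) (fun p => (past p.2, present p.2))
      (π.prod μ) :=
    indepFun_prod (X := fun w : ℝ≥0 => (w, ())) (Y := fun ω => (past ω, present ω))
      (by fun_prop) (by fun_prop)
  have hfull := indepFun_prodMk_prodMk_of_indepFun (X' := fun _ => ()) measurable_fst
    measurable_const (hpast_m.comp measurable_snd) (hpresent_m.comp measurable_snd)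
    (indepFun_const_right _ _) hind hstart
  have hW : IndepFun (fun p : ℝ≥0 × Ω => reflectedProcess V Y p.1 i p.2)
      (fun p => present p.2) (π.prod μ) := by
    simp_rw [reflectedProcess_eq_reflectedOfPast]
    exact hfull.comp (measurable_reflectedOfPast i) measurable_snd
  have hWm := measurable_reflectedProcess hVmeas hYmeas i
  rw [indepFun_iff_map_prod_eq_prod_map_map hWm.aemeasurable (by fun_prop)] at hW
  have hpr : (π.prod μ).map (fun p => present p.2) = μ.map present := by
    conv_rhs => rw [← hsnd, Measure.map_map hpresent_m measurable_snd]
    rfl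
  rw [pushStep, ← hpr, ← hW, Measure.map_map measurable_reflectedStep (by fun_prop)]
  rfl

end Independence

theorem theorem3 {Ω : Type*} [MeasurableSpace Ω] (μ : Measure Ω) [IsProbabilityMeasure μ]
    (V Y : ℕ → Ω → ℝ)
    (hVmeas : ∀ i, Measurable (V i)) (hYmeas : ∀ i, Measurable (Y i))
    (hVindep : iIndepFun V μ) (hYindep : iIndepFun Y μ)
    (hVident : ∀ i, IdentDistrib (V i) (V 0) μ μ)
    (hYident : ∀ i, IdentDistrib (Y i) (Y 0) μ μ)
    (hVY : IndepFun (fun ω (i : ℕ) => V i ω) (fun ω (i : ℕ) => Y i ω) μ)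
    (hV : 0 < μ {ω | V 0 ω ≤ 0})
    (hY : ∀ᵐ ω ∂μ, 0 ≤ Y 0 ω) :
    ∃ π : Measure ℝ≥0, IsStationaryDistribution μ V Y π := by
  have hpair : ∀ i, IndepFun (V i) (Y i) μ := fun i =>
    hVY.comp (measurable_pi_apply i) (measurable_pi_apply i)
  have hlaw : ∀ i, μ.map (fun ω => (V i ω, Y i ω)) = μ.map (fun ω => (V 0 ω, Y 0 ω)) := by
    intro i
    rw [(hpair i).map_prod_eq_prod_map_map (hVmeas i).aemeasurable (hYmeas i).aemeasurable,
      (hpair 0).map_prod_eq_prod_map_map (hVmeas 0).aemeasurable (hYmeas 0).aemeasurable,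
      (hVident i).map_eq, (hYident i).map_eq]
  have hm0 : Measurable fun ω => (V 0 ω, Y 0 ω) := (hVmeas 0).prodMk (hYmeas 0)
  have := Measure.isProbabilityMeasure_map (μ := μ) hm0.aemeasurable
  have hlt : μ.map (fun ω => (V 0 ω, Y 0 ω)) {b | 0 < b.1} < 1 := by
    rw [Measure.map_apply hm0 (measurableSet_lt measurable_const measurable_fst)]
    refine lt_of_le_of_ne prob_le_one fun h => hV.ne' ?_
    rw [← prob_compl_eq_zero_iff (hm0 (measurableSet_lt measurable_const measurable_fst))] at h
    convert h using 2
    ext ω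
    simp
  obtain ⟨π, hπ, hinv⟩ := exists_pushStep_reflectedStep_eq_self _ hlt
  refine ⟨π, hπ, fun i => ?_⟩
  induction i with
  | zero =>
    change (π.prod μ).map Prod.fst = π
    simp
  | succ i ih =>
    rw [map_reflectedProcess_succ hVmeas hYmeas hVindep hYindep hVY, ih, hlaw, hinv]
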